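/- **Uniqueness theorem.** Consider a finite plane electrical circuit made of resistors and exactly one battery. That is, take a finite plane multigraph without loops in $\mathbb R^2$, whose vertices (terminals) are distinct points and whose edges are simple polygonal arcs joining two distinct terminals, such that the interior of an edge contains no terminal and no point of another edge. One edge is the battery, with given voltage $U\in\mathbb R$, directed from its negative pole to its positive pole. The other edges are the resistors $k$, with given resistances $R_k>0$ and arbitrarily chosen directions. The unknowns are the real currents $I_k$ through the resistors and $I$ through the battery. The Kirchhoff system consists of the following equations. 1. At each terminal the sum of the incoming currents equals the sum of the outgoing currents (the battery current included). 2. For each part into which the circuit divides the plane (each connected component of the complement), going around the boundary of this part with the part on the left (counterclockwise, for a bounded part), the algebraic sum of the voltages $I_kR_k$ on the resistors passed equals the algebraic sum of the battery voltages $U$ passed. A voltage is taken with the sign $+$ if the direction of the edge agrees with the direction of traversal and with the sign $-$ if it is opposite; an edge that is passed twice is counted twice. This system has exactly one solution. The same holds if the equations 2 are imposed only for the bounded parts. -/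

import Mathlib

open Topology

/-- A simple polygonal arc in the plane `ℂ`, running through its corners `corner 0, …, corner (n + 1)`
along `n + 1` straight segments (so at least one), with no self-intersections. -/
structure PolygonalArc where
  n : ℕ
  corner : Fin (n + 2) → ℂ
  corner_injective : Function.Injective corner
  corner_notMem : ∀ (i : Fin (n + 1)) (j : Fin (n + 2)),
    corner j ∉ openSegment ℝ (corner i.castSucc) (corner i.succ)
  segments_disjoint : ∀ i j : Fin (n + 1), i ≠ j →
    Disjoint (openSegment ℝ (corner i.castSucc) (corner i.succ))
      (openSegment ℝ (corner j.castSucc) (corner j.succ))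

namespace PolygonalArc

/-- Starting point of the arc. -/
def first (γ : PolygonalArc) : ℂ := γ.corner 0

/-- End point of the arc. -/
def last (γ : PolygonalArc) : ℂ := γ.corner (Fin.last (γ.n + 1))

/-- The set of all points of the arc. -/
def carrier (γ : PolygonalArc) : Set ℂ :=
  ⋃ i : Fin (γ.n + 1), segment ℝ (γ.corner i.castSucc) (γ.corner i.succ)

/-- The arc without its two end points. -/
def inner (γ : PolygonalArc) : Set ℂ := γ.carrier \ {γ.first, γ.last}

/-- The set `f` lies immediately to the left of the arc: near some point `p` of one of its open
segments, a short step from `p` perpendicular to the segment, to the left of the direction of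
travel, ends in `f`. -/
def HasOnLeft (γ : PolygonalArc) (f : Set ℂ) : Prop :=
  ∃ i : Fin (γ.n + 1), ∃ p ∈ openSegment ℝ (γ.corner i.castSucc) (γ.corner i.succ),
    ∀ᶠ ε : ℝ in 𝓝[>] 0,
      p + (ε : ℂ) * (Complex.I * (γ.corner i.succ - γ.corner i.castSucc)) ∈ f

/-- The set `f` lies immediately to the right of the arc. -/
def HasOnRight (γ : PolygonalArc) (f : Set ℂ) : Prop :=
  ∃ i : Fin (γ.n + 1), ∃ p ∈ openSegment ℝ (γ.corner i.castSucc) (γ.corner i.succ),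
    ∀ᶠ ε : ℝ in 𝓝[>] 0,
      p - (ε : ℂ) * (Complex.I * (γ.corner i.succ - γ.corner i.castSucc)) ∈ f

end PolygonalArc

/-- A plane multigraph with vertices indexed by `V` and directed edges indexed by `E`: the vertices
are distinct points of the plane, every edge is a polygonal arc between two vertices, and the
interior of an edge contains no vertex and no point of another edge. Several edges may join the
same two vertices, and no connectedness is required. -/
structure PlaneMultigraph (V E : Type*) where
  pos : V → ℂ
  pos_injective : Function.Injective pos
  arc : E → PolygonalArc
  src : E → V
  tgt : E → V
  arc_first : ∀ e, (arc e).first = pos (src e)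
  arc_last : ∀ e, (arc e).last = pos (tgt e)
  vertex_notMem : ∀ e v, pos v ∉ (arc e).inner
  edges_disjoint : ∀ e e', e ≠ e' → Disjoint (arc e).inner (arc e').carrier

namespace PlaneMultigraph

variable {V E : Type*}

/-- The set of all points of the plane that belong to the graph. -/
def support (G : PlaneMultigraph V E) : Set ℂ :=
  Set.range G.pos ∪ ⋃ e, (G.arc e).carrier

/-- The parts into which the graph divides the plane: the connected components of the complement
of the graph (the unbounded one included). -/
def faces (G : PlaneMultigraph V E) : Set (Set ℂ) :=
  {f | ∃ x ∈ G.supportᶜ, f = connectedComponentIn G.supportᶜ x}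

/-- The parts that are bounded, that is, all but the outer one. -/
def boundedFaces (G : PlaneMultigraph V E) : Set (Set ℂ) :=
  {f | f ∈ G.faces ∧ Bornology.IsBounded f}

open scoped Classical in
/-- The algebraic number of times that the contour of `f` passes the edge `e`. The contour is
traversed with `f` on its left, which is counterclockwise if `f` is bounded. So it passes `e`
along the direction of `e` (counted `+1`) if `f` is to the left of `e`, and against the
direction of `e` (counted `-1`) if `f` is to the right of `e`. -/
noncomputable def contour (G : PlaneMultigraph V E) (f : Set ℂ) (e : E) : ℝ :=
  (if (G.arc e).HasOnLeft f then 1 else 0) - (if (G.arc e).HasOnRight f then 1 else 0)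

end PlaneMultigraph

/-- A plane electrical circuit made of one battery and of resistors indexed by `ρ`, with terminals
indexed by `V`. The edge `none` is the battery, directed from its negative to its positive pole;
the edge `some k` is the resistor `k` with a chosen direction. -/
structure PlaneCircuit (V ρ : Type*) extends PlaneMultigraph V (Option ρ) where
  resistance : ρ → ℝ
  resistance_pos : ∀ k, 0 < resistance k
  voltage : ℝ

namespace PlaneCircuit

variable {V ρ : Type*} [Fintype ρ]

open scoped Classical in
/-- First Kirchhoff law: at every terminal the sum of the incoming currents equals the sum of the
outgoing currents. Here `I (some k)` is the current through the resistor `k` and `I none` is the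
current through the battery. -/
def NodeLaw (C : PlaneCircuit V ρ) (I : Option ρ → ℝ) : Prop :=
  ∀ v : V, (∑ e : Option ρ, if C.tgt e = v then I e else 0) =
    ∑ e : Option ρ, if C.src e = v then I e else 0

/-- Second Kirchhoff law for the contour of `f`: the algebraic sum of the voltages on its resistors
equals the algebraic sum of the battery voltages in it. -/
def LoopLaw (C : PlaneCircuit V ρ) (f : Set ℂ) (I : Option ρ → ℝ) : Prop :=
  (∑ k : ρ, C.contour f (some k) * (I (some k) * C.resistance k)) =
    C.contour f none * C.voltage

/-- The currents `I` solve the Kirchhoff system made of the node laws at all terminals and of the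
loop laws for the contours of the parts `f ∈ F`. -/
def SolvesKirchhoff (C : PlaneCircuit V ρ) (F : Set (Set ℂ)) (I : Option ρ → ℝ) : Prop :=
  C.NodeLaw I ∧ ∀ f ∈ F, C.LoopLaw f I

end PlaneCircuit

/-! The node laws cut out the cycle space `cycleSpace`. The contours of the parts are cycles
(`isCycle_contour`), and a vector orthogonal to the contours of the bounded parts is orthogonal to
all cycles (`sum_mul_eq_zero_of_boundedFaces`). Hence either set of loop laws says that `power I z =
z none * voltage` for every cycle `z` (`loopLaw_iff_of_subset`). The form `power` is positive
definite on the cycle space, so it identifies this finite-dimensional space with its dual, and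
exactly one `I` represents the functional of the battery. Neither connectedness nor Euler's formula
enters.

Both facts about contours are proved for the straight segments of all edges. On a small circle
around a point the indicator function of a part jumps only at the spokes; its jumps over one turn
add up to zero, so the contour enters the point as often as it leaves it (`sum_jump_eq`).
Conversely, the imaginary part of `winding` for a cycle `z` is constant on every part, jumps by `2 *
π * z i` across segment `i`, and vanishes on unbounded parts. So `2 * π * z` is a combination of
bounded contours with these values as coefficients (`sum_mul_cycle_eq_zero`). -/

/-! ### Local sides of a flat piece of a plane set -/

section Sides

open Metric ComplexConjugate

/-- Small steps from `p` perpendicular to `d`, to the left of `d`, end in `f`. -/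
def SideMem (f : Set ℂ) (p d : ℂ) : Prop :=
  ∀ᶠ ε : ℝ in 𝓝[>] 0, p + (ε : ℂ) * (Complex.I * d) ∈ f

/-- Near `p` the set `K` is contained in the line through `p` with direction `d`. -/
def FlatAt (K : Set ℂ) (p d : ℂ) : Prop :=
  ∃ η > 0, ∀ x ∈ ball p η, x ∈ K → ((x - p) * conj d).im = 0

/-- The half of the ball around `p` that lies to the left of the direction `d`. -/
def halfBall (p d : ℂ) (η : ℝ) : Set ℂ := ball p η ∩ {x | 0 < ((x - p) * conj d).im}

theorem convex_halfBall (p d : ℂ) (η : ℝ) : Convex ℝ (halfBall p d η) := by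
  refine (convex_ball p η).inter ?_
  intro x hx y hy s t hs ht hst
  simp only [Set.mem_ofPred_eq] at hx hy ⊢
  have : ((s • x + t • y - p) * conj d).im
      = s * ((x - p) * conj d).im + t * ((y - p) * conj d).im := by
    have h : (s • x + t • y - p) * conj d
        = (s : ℂ) * ((x - p) * conj d) + (t : ℂ) * ((y - p) * conj d) := by
      have : (s : ℂ) + t = 1 := by exact_mod_cast hst
      simp only [Complex.real_smul]
      linear_combination p * conj d * this
    rw [h, Complex.add_im, Complex.im_ofReal_mul, Complex.im_ofReal_mul]
  rw [this]
  rcases hs.eq_or_lt with rfl | hs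
  · have : t = 1 := by linarith
    subst this; simpa using hy
  · have := mul_pos hs hx
    have := mul_nonneg ht hy.le
    linarith

theorem FlatAt.neg {K : Set ℂ} {p d : ℂ} (h : FlatAt K p d) : FlatAt K p (-d) := by
  obtain ⟨η, hη, h⟩ := h
  refine ⟨η, hη, fun x hx hxK => ?_⟩
  rw [map_neg, mul_neg, Complex.neg_im, h x hx hxK, neg_zero]

theorem im_step (q p d : ℂ) (ε : ℝ) :
    ((q + (ε : ℂ) * (Complex.I * d) - p) * conj d).im
      = ((q - p) * conj d).im + ε * Complex.normSq d := by
  have : (q + (ε : ℂ) * (Complex.I * d) - p) * conj d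
      = (q - p) * conj d + (ε : ℂ) * (Complex.I * (Complex.normSq d : ℂ)) := by
    rw [← Complex.mul_conj]; ring
  rw [this, Complex.add_im, Complex.im_ofReal_mul, Complex.I_mul_im, Complex.ofReal_re]

theorem tendsto_step (q d : ℂ) :
    Filter.Tendsto (fun ε : ℝ => q + (ε : ℂ) * (Complex.I * d)) (𝓝[>] 0) (𝓝 q) := by
  have : Continuous (fun ε : ℝ => q + (ε : ℂ) * (Complex.I * d)) := by fun_prop
  have := this.tendsto 0
  simp only [Complex.ofReal_zero, zero_mul, add_zero] at this
  exact this.mono_left nhdsWithin_le_nhds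

theorem eventually_mem_halfBall {p q d : ℂ} {η : ℝ} (hd : d ≠ 0) (hq : q ∈ ball p η)
    (hqd : ((q - p) * conj d).im = 0) :
    ∀ᶠ ε : ℝ in 𝓝[>] 0, q + (ε : ℂ) * (Complex.I * d) ∈ halfBall p d η := by
  filter_upwards [tendsto_step q d (isOpen_ball.mem_nhds hq), self_mem_nhdsWithin] with ε h hε
  refine ⟨h, ?_⟩
  simp only [Set.mem_ofPred_eq]
  rw [im_step, hqd, zero_add]
  exact mul_pos hε (Complex.normSq_pos.2 hd)

/-- The half ball lies off the line that contains `K` near `p`, and it is convex; being connected in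
the complement, it cannot be split by a component. -/
theorem FlatAt.exists_halfBall {K : Set ℂ} {p d x₀ : ℂ} (hK : FlatAt K p d) :
    ∃ η > 0, halfBall p d η ⊆ Kᶜ ∧ (halfBall p d η ⊆ connectedComponentIn Kᶜ x₀ ∨
      Disjoint (halfBall p d η) (connectedComponentIn Kᶜ x₀)) := by
  obtain ⟨η, hη, h⟩ := hK
  have hsub : halfBall p d η ⊆ Kᶜ := fun x hx hxK => hx.2.ne' (h x hx.1 hxK)
  refine ⟨η, hη, hsub, ?_⟩
  by_cases hy : ∃ y ∈ halfBall p d η, y ∈ connectedComponentIn Kᶜ x₀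
  · obtain ⟨y, hy, hyf⟩ := hy
    left
    rw [connectedComponentIn_eq hyf]
    exact (convex_halfBall p d η).isPreconnected.subset_connectedComponentIn hy hsub
  · push Not at hy
    exact Or.inr (Set.disjoint_left.2 hy)

/-- One half ball decides the side of `f` for every nearby `q` on the line, not only for its centre;
this makes the side locally constant. -/
theorem sideMem_iff_halfBall_subset {p q d : ℂ} {η : ℝ} {f : Set ℂ} (hd : d ≠ 0)
    (hq : q ∈ ball p η) (hqd : ((q - p) * conj d).im = 0)
    (hf : halfBall p d η ⊆ f ∨ Disjoint (halfBall p d η) f) :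
    SideMem f q d ↔ halfBall p d η ⊆ f := by
  have hev := eventually_mem_halfBall hd hq hqd
  constructor
  · intro h
    obtain ⟨ε, h1, h2⟩ := (hev.and h).exists
    exact hf.resolve_right fun hdis => Set.disjoint_left.1 hdis h1 h2
  · intro h
    exact hev.mono fun ε hε => h hε

/-- Points that approach `p` from the left of `d` are finally in `f` or finally outside `f`,
according to the side of `p` on which `f` lies. -/
theorem FlatAt.eventually_mem_iff {K : Set ℂ} {p d x₀ : ℂ} (hK : FlatAt K p d) (hd : d ≠ 0)
    {α : Type*} {l : Filter α} {x : α → ℂ} (hx : Filter.Tendsto x l (𝓝 p))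
    (hl : ∀ᶠ t in l, 0 < ((x t - p) * conj d).im) :
    ∀ᶠ t in l, (x t ∈ connectedComponentIn Kᶜ x₀ ↔
      SideMem (connectedComponentIn Kᶜ x₀) p d) := by
  obtain ⟨η, hη, -, h⟩ := hK.exists_halfBall (x₀ := x₀)
  have hiff := sideMem_iff_halfBall_subset hd (mem_ball_self hη) (by simp) h
  filter_upwards [hx (ball_mem_nhds p hη), hl] with t h1 h2
  rw [hiff]
  have hmem : x t ∈ halfBall p d η := ⟨h1, h2⟩
  exact ⟨fun hxt => h.resolve_right fun hdis => Set.disjoint_left.1 hdis hmem hxt,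
    fun hsub => hsub hmem⟩

theorem im_sub_mul_conj_eq_zero {a b p q : ℂ} (hp : p ∈ segment ℝ a b)
    (hq : q ∈ segment ℝ a b) : ((q - p) * conj (b - a)).im = 0 := by
  rw [segment_eq_image'] at hp hq
  obtain ⟨s, -, rfl⟩ := hp
  obtain ⟨t, -, rfl⟩ := hq
  have : (a + t • (b - a) - (a + s • (b - a))) * conj (b - a)
      = ((t - s : ℝ) : ℂ) * ((Complex.normSq (b - a) : ℝ) : ℂ) := by
    rw [← Complex.mul_conj]; simp only [Complex.real_smul, Complex.ofReal_sub]; ring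
  rw [this, ← Complex.ofReal_mul, Complex.ofReal_im]

theorem isPreconnected_openSegment (a b : ℂ) : IsPreconnected (openSegment ℝ a b) :=
  (convex_openSegment a b).isPreconnected

/-- Along an open segment the component to its left does not change. -/
theorem sideMem_iff_of_mem_openSegment {K : Set ℂ} {a b d p q x₀ : ℂ} (hd : d ≠ 0)
    (hda : d = b - a ∨ d = -(b - a))
    (hflat : ∀ p ∈ openSegment ℝ a b, FlatAt K p d)
    (hp : p ∈ openSegment ℝ a b) (hq : q ∈ openSegment ℝ a b) :
    SideMem (connectedComponentIn Kᶜ x₀) p d ↔ SideMem (connectedComponentIn Kᶜ x₀) q d := by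
  have him : ∀ p ∈ openSegment ℝ a b, ∀ q ∈ openSegment ℝ a b, ((q - p) * conj d).im = 0 := by
    intro p hp q hq
    rcases hda with rfl | rfl
    · exact im_sub_mul_conj_eq_zero (openSegment_subset_segment _ _ _ hp)
        (openSegment_subset_segment _ _ _ hq)
    · rw [map_neg, mul_neg, Complex.neg_im, im_sub_mul_conj_eq_zero
        (openSegment_subset_segment _ _ _ hp) (openSegment_subset_segment _ _ _ hq), neg_zero]
  -- Having `f` on the same side is an equivalence relation, so on a connected set it suffices to
  -- check it locally.
  refine (isPreconnected_openSegment a b).induction₂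
    (fun p q => SideMem (connectedComponentIn Kᶜ x₀) p d ↔
      SideMem (connectedComponentIn Kᶜ x₀) q d) ?_ (fun x y z _ _ _ h h' => h.trans h')
      (fun x y _ _ h => h.symm) hp hq
  intro p hp
  obtain ⟨η, hη, -, h⟩ := (hflat p hp).exists_halfBall (x₀ := x₀)
  filter_upwards [self_mem_nhdsWithin, mem_nhdsWithin_of_mem_nhds (ball_mem_nhds p hη)] with q hq hqb
  rw [sideMem_iff_halfBall_subset hd (mem_ball_self hη) (by simp) h,
    sideMem_iff_halfBall_subset hd hqb (him p hp q hq) h]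

end Sides

/-! ### Jumps of a component's indicator along a circle -/

section Star

open ComplexConjugate Filter

/-- A function on the line all of whose one-sided germs at every point agree is constant up to
isolated points. -/
theorem exists_eventually_eq_of_removable {k : ℝ → ℝ}
    (hk : ∀ x, ∃ v, (∀ᶠ t in 𝓝[>] x, k t = v) ∧ ∀ᶠ t in 𝓝[<] x, k t = v) :
    ∃ v, ∀ x, ∀ᶠ t in 𝓝[≠] x, k t = v := by
  choose v hv using hk
  have hv' : ∀ x, ∀ᶠ t in 𝓝[≠] x, k t = v x := by
    intro x
    rw [← nhdsLT_sup_nhdsGT, eventually_sup]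
    exact ⟨(hv x).2, (hv x).1⟩
  -- Near `x` the function `k` equals `v x` off `x`, hence also around each nearby `y ≠ x`, which
  -- forces `v y = v x`.
  have hloc : IsLocallyConstant v := by
    rw [IsLocallyConstant.iff_eventually_eq]
    intro x
    have h := eventually_eventually_nhdsWithin.2 (hv' x)
    rw [eventually_nhdsWithin_iff] at h
    filter_upwards [h] with y hy
    rcases eq_or_ne y x with rfl | hne
    · rfl
    · have h1 : ∀ᶠ t in 𝓝[≠] y, k t = v x := by
        have h2 := hy hne
        rw [eventually_nhdsWithin_iff] at h2
        filter_upwards [h2.filter_mono nhdsWithin_le_nhds,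
          mem_nhdsWithin_of_mem_nhds (isOpen_ne.mem_nhds hne)] with t ht htx
        exact ht htx
      obtain ⟨t, ht1, ht2⟩ := (h1.and (hv' y)).exists
      exact ht2.symm.trans ht1
  refine ⟨v 0, fun x => ?_⟩
  rw [← hloc.apply_eq_of_preconnectedSpace x 0]
  exact hv' x

theorem eventually_floor_right (α x : ℝ) :
    ∀ᶠ t in 𝓝[>] x, ⌊(t - α) / (2 * Real.pi)⌋ = ⌊(x - α) / (2 * Real.pi)⌋ := by
  have h : Tendsto (fun t : ℝ => (t - α) / (2 * Real.pi)) (𝓝[>] x)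
      (𝓝[≥] ((x - α) / (2 * Real.pi))) := by
    refine tendsto_nhdsWithin_iff.2 ⟨?_, ?_⟩
    · exact (Continuous.tendsto (by fun_prop) x).mono_left nhdsWithin_le_nhds
    · filter_upwards [self_mem_nhdsWithin] with t ht
      have : x < t := ht
      have := Real.pi_pos
      simp only [Set.mem_Ici]
      gcongr
  exact tendsto_pure.1 ((tendsto_floor_right_pure_floor _).comp h)

theorem eventually_floor_left (α x : ℝ) :
    ∀ᶠ t in 𝓝[<] x, ⌊(t - α) / (2 * Real.pi)⌋ = ⌈(x - α) / (2 * Real.pi)⌉ - 1 := by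
  have h : Tendsto (fun t : ℝ => (t - α) / (2 * Real.pi)) (𝓝[<] x)
      (𝓝[<] ((x - α) / (2 * Real.pi))) := by
    refine tendsto_nhdsWithin_iff.2 ⟨?_, ?_⟩
    · exact (Continuous.tendsto (by fun_prop) x).mono_left nhdsWithin_le_nhds
    · filter_upwards [self_mem_nhdsWithin] with t ht
      have : t < x := ht
      have := Real.pi_pos
      simp only [Set.mem_Iio]
      gcongr
  exact tendsto_pure.1 ((tendsto_floor_left_pure_ceil_sub_one _).comp h)

/-- The jumps over one period of a periodic piecewise constant function add up to zero. -/
theorem sum_jumps_eq_zero {κ : Type*} [Fintype κ] {h : ℝ → ℝ}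
    (hper : ∀ x, h (x + 2 * Real.pi) = h x) (α J : κ → ℝ)
    (hJ : ∀ x, ∃ p m, (∀ᶠ t in 𝓝[>] x, h t = p) ∧ (∀ᶠ t in 𝓝[<] x, h t = m) ∧
      p - m = ∑ i, J i * ((⌊(x - α i) / (2 * Real.pi)⌋ - (⌈(x - α i) / (2 * Real.pi)⌉ - 1) : ℤ) : ℝ)) :
    ∑ i, J i = 0 := by
  -- The floor functions are step functions with unit jumps at `α i + 2πℤ`. Subtracting them removes
  -- all jumps of `h`; over one period `h` returns while every floor grows by one, so `k` drops by
  -- `∑ i, J i`.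
  set k : ℝ → ℝ := fun x => h x - ∑ i, J i * (⌊(x - α i) / (2 * Real.pi)⌋ : ℝ) with hkdef
  have hk : ∀ x, ∃ v, (∀ᶠ t in 𝓝[>] x, k t = v) ∧ ∀ᶠ t in 𝓝[<] x, k t = v := by
    intro x
    obtain ⟨p, m, hp, hm, hpm⟩ := hJ x
    refine ⟨p - ∑ i, J i * (⌊(x - α i) / (2 * Real.pi)⌋ : ℝ), ?_, ?_⟩
    · filter_upwards [hp, eventually_all.2 fun i => eventually_floor_right (α i) x] with t h1 h2
      simp only [hkdef, h1, h2]
    · filter_upwards [hm, eventually_all.2 fun i => eventually_floor_left (α i) x] with t h1 h2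
      simp only [hkdef, h1, h2]
      simp only [Int.cast_sub, mul_sub, Finset.sum_sub_distrib] at hpm ⊢
      linarith
  obtain ⟨v, hv⟩ := exists_eventually_eq_of_removable hk
  have h1 : ∀ᶠ t in 𝓝[>] (0 : ℝ), k t = v :=
    (hv 0).filter_mono (nhdsWithin_mono _ fun x hx => ne_of_gt hx)
  have h2 : ∀ᶠ t in 𝓝[>] (0 : ℝ), k (t + 2 * Real.pi) = v := by
    have ht : Tendsto (fun t : ℝ => t + 2 * Real.pi) (𝓝[>] 0) (𝓝[≠] (0 + 2 * Real.pi)) := by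
      refine tendsto_nhdsWithin_iff.2 ⟨?_, ?_⟩
      · exact (Continuous.tendsto (by fun_prop) 0).mono_left nhdsWithin_le_nhds
      · filter_upwards [self_mem_nhdsWithin] with t ht
        have : 0 < t := ht
        simp [this.ne']
    exact ht.eventually (hv _)
  obtain ⟨t, ht1, ht2⟩ := (h1.and h2).exists
  have hfl : ∀ i, ⌊(t + 2 * Real.pi - α i) / (2 * Real.pi)⌋ = ⌊(t - α i) / (2 * Real.pi)⌋ + 1 := by
    intro i
    rw [← Int.floor_add_one]
    congr 1
    have := Real.pi_pos
    field_simp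
    ring
  simp only [hkdef, hper, hfl, Int.cast_add, Int.cast_one, mul_add, mul_one,
    Finset.sum_add_distrib] at ht1 ht2
  linarith

/-- The left side is the jump of the floor function at `x`, nonzero only when its argument is an
integer, that is, when `x` and `α` are the same angle. -/
theorem floor_sub_ceil_sub_one (x α : ℝ) :
    ⌊(x - α) / (2 * Real.pi)⌋ - (⌈(x - α) / (2 * Real.pi)⌉ - 1)
      = open scoped Classical in
        if Complex.exp (x * Complex.I) = Complex.exp (α * Complex.I) then (1 : ℤ) else 0 := by
  have hiff : Complex.exp (x * Complex.I) = Complex.exp (α * Complex.I) ↔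
      ∃ n : ℤ, (x - α) / (2 * Real.pi) = n := by
    rw [Complex.exp_eq_exp_iff_exists_int]
    refine exists_congr fun n => ?_
    have hpi := Real.pi_pos
    rw [div_eq_iff (by positivity)]
    constructor
    · intro h
      have h' : (x : ℂ) * Complex.I = ((α + n * (2 * Real.pi) : ℝ) : ℂ) * Complex.I := by
        rw [h]; push_cast; ring
      have := mul_right_cancel₀ Complex.I_ne_zero h'
      have := Complex.ofReal_injective this
      linarith
    · intro h
      have : x = α + n * (2 * Real.pi) := by linarith
      rw [this]; push_cast; ring
  split_ifs with h
  · obtain ⟨n, hn⟩ := hiff.1 h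
    rw [hn, Int.floor_intCast, Int.ceil_intCast]; ring
  · have h1 : ⌈(x - α) / (2 * Real.pi)⌉ = ⌊(x - α) / (2 * Real.pi)⌋ + 1 := by
      rw [Int.ceil_eq_iff]
      push_cast
      refine ⟨?_, (Int.lt_floor_add_one _).le⟩
      have h2 := Int.floor_le ((x - α) / (2 * Real.pi))
      rcases h2.eq_or_lt with h3 | h3
      · exact absurd (hiff.2 ⟨_, h3.symm⟩) h
      · linarith
    rw [h1]; ring

theorem eventually_mem_component_iff {K : Set ℂ} (hK : IsClosed K) {x x₀ : ℂ} (hx : x ∉ K) :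
    ∀ᶠ y in 𝓝 x, (y ∈ connectedComponentIn Kᶜ x₀ ↔ x ∈ connectedComponentIn Kᶜ x₀) := by
  have hopen : IsOpen (connectedComponentIn Kᶜ x) := hK.isOpen_compl.connectedComponentIn
  filter_upwards [hopen.mem_nhds (mem_connectedComponentIn hx)] with y hy
  have h1 : connectedComponentIn Kᶜ x = connectedComponentIn Kᶜ y := connectedComponentIn_eq hy
  have hyK : y ∈ Kᶜ := connectedComponentIn_subset _ _ hy
  constructor
  · intro h
    rw [connectedComponentIn_eq h, ← h1]
    exact mem_connectedComponentIn hx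
  · intro h
    rw [connectedComponentIn_eq h, h1]
    exact mem_connectedComponentIn hyK

open scoped Classical in
/-- Let `K` meet a circle around `c` only in points of finitely many spokes. Then, going around `c`,
a component of the complement of `K` is entered as often as it is left. -/
theorem sum_side_star_eq_zero {κ : Type*} [Fintype κ] {K : Set ℂ} (hK : IsClosed K) {c x₀ : ℂ}
    {r : ℝ} (hr : 0 < r) {w p : κ → ℂ} (hw : ∀ i, w i ≠ 0)
    (hp : ∀ i, p i = c + r * Complex.exp ((w i).arg * Complex.I)) (hpinj : Function.Injective p)
    (hpK : ∀ i, p i ∈ K) (hflat : ∀ i, FlatAt K (p i) (w i))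
    (hKr : ∀ x ∈ K, dist x c = r → ∃ i, x = p i) :
    ∑ i, ((if SideMem (connectedComponentIn Kᶜ x₀) (p i) (w i) then (1 : ℝ) else 0)
      - (if SideMem (connectedComponentIn Kᶜ x₀) (p i) (-w i) then (1 : ℝ) else 0)) = 0 := by
  set f := connectedComponentIn Kᶜ x₀ with hf
  set φ : ℝ → ℂ := fun t => c + r * Complex.exp (t * Complex.I) with hφ
  have hφcont : Continuous φ := by fun_prop
  have hφeq : ∀ (t : ℝ) i, Complex.exp (t * Complex.I) = Complex.exp ((w i).arg * Complex.I) ↔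
      φ t = p i := by
    intro t i
    simp only [hφ, hp, add_right_inj]
    rw [mul_right_inj' (by exact_mod_cast hr.ne')]
  refine sum_jumps_eq_zero (h := fun t => if φ t ∈ f then 1 else 0) ?_ (fun i => (w i).arg) _ ?_
  · intro x
    have : φ (x + 2 * Real.pi) = φ x := by
      simp only [hφ]
      push_cast
      rw [add_mul, Complex.exp_add, Complex.exp_two_pi_mul_I, mul_one]
    simp only [this]
  intro x
  simp only [floor_sub_ceil_sub_one, hφeq]
  by_cases hx : φ x ∈ K
  · obtain ⟨i, hi⟩ := hKr _ hx (by
      simp only [hφ]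
      rw [dist_eq_norm, add_sub_cancel_left, norm_mul, Complex.norm_exp_ofReal_mul_I, mul_one, Complex.norm_real, Real.norm_eq_abs,
        abs_of_pos hr])
    -- The sign of the sine shows that the circle runs to the left of the spoke just after `x` and
    -- to its right just before.
    have him : ∀ t : ℝ, ((φ t - p i) * conj (w i)).im = r * ‖w i‖ * Real.sin (t - x) := by
      intro t
      have h1 : Complex.exp (x * Complex.I) = Complex.exp ((w i).arg * Complex.I) :=
        (hφeq x i).2 hi
      have h2 : w i = ‖w i‖ * Complex.exp (x * Complex.I) := by
        rw [h1, Complex.norm_mul_exp_arg_mul_I]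
      have h3 : conj (w i) = ‖w i‖ * Complex.exp (-(x * Complex.I)) := by
        conv_lhs => rw [h2]
        rw [map_mul, Complex.conj_ofReal, ← Complex.exp_conj, map_mul, Complex.conj_I,
          Complex.conj_ofReal, mul_neg]
      have h4 : (φ t - p i) * conj (w i)
          = ((r * ‖w i‖ : ℝ) : ℂ) * (Complex.exp (((t - x : ℝ) : ℂ) * Complex.I) - 1) := by
        rw [h3, ← hi]
        simp only [hφ]
        have h5 : Complex.exp (((t - x : ℝ) : ℂ) * Complex.I)
            = Complex.exp (t * Complex.I) * Complex.exp (-(x * Complex.I)) := by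
          rw [← Complex.exp_add]; congr 1; push_cast; ring
        have h6 : Complex.exp (x * Complex.I) * Complex.exp (-(x * Complex.I)) = 1 := by
          rw [← Complex.exp_add, add_neg_cancel, Complex.exp_zero]
        rw [h5]
        push_cast
        linear_combination (-(r : ℂ) * ‖w i‖) * h6
      rw [h4, Complex.im_ofReal_mul, Complex.sub_im, Complex.exp_ofReal_mul_I_im, Complex.one_im,
        sub_zero]
    have htend : Tendsto φ (𝓝 x) (𝓝 (p i)) := hi ▸ hφcont.tendsto x
    have hpos : 0 < r * ‖w i‖ := mul_pos hr (norm_pos_iff.2 (hw i))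
    refine ⟨if SideMem f (p i) (w i) then 1 else 0, if SideMem f (p i) (-w i) then 1 else 0,
      ?_, ?_, ?_⟩
    · have hev : ∀ᶠ t in 𝓝[>] x, 0 < ((φ t - p i) * conj (w i)).im := by
        filter_upwards [Ioo_mem_nhdsGT (show x < x + Real.pi by linarith [Real.pi_pos])] with t ht
        rw [him]
        exact mul_pos hpos (Real.sin_pos_of_pos_of_lt_pi (by linarith [ht.1]) (by linarith [ht.2]))
      filter_upwards [(hflat i).eventually_mem_iff (x₀ := x₀) (hw i)
        (htend.mono_left nhdsWithin_le_nhds) hev] with t ht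
      simp only [hf, ht]
    · have hev : ∀ᶠ t in 𝓝[<] x, 0 < ((φ t - p i) * conj (-w i)).im := by
        filter_upwards [Ioo_mem_nhdsLT (show x - Real.pi < x by linarith [Real.pi_pos])] with t ht
        rw [map_neg, mul_neg, Complex.neg_im, him, neg_pos]
        exact mul_neg_of_pos_of_neg hpos
          (Real.sin_neg_of_neg_of_neg_pi_lt (by linarith [ht.2]) (by linarith [ht.1]))
      filter_upwards [(hflat i).neg.eventually_mem_iff (x₀ := x₀) (neg_ne_zero.2 (hw i))
        (htend.mono_left nhdsWithin_le_nhds) hev] with t ht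
      simp only [hf, ht]
    · rw [Finset.sum_eq_single i]
      · simp [hi]
      · intro j _ hj
        rw [hi, if_neg (fun h => hj (hpinj h).symm)]
        simp
      · simp
  · refine ⟨if φ x ∈ f then 1 else 0, if φ x ∈ f then 1 else 0, ?_, ?_, ?_⟩
    · filter_upwards [nhdsWithin_le_nhds
        ((hφcont.tendsto x).eventually (eventually_mem_component_iff hK (x₀ := x₀) hx))] with t ht
      simp only [hf, ht]
    · filter_upwards [nhdsWithin_le_nhds
        ((hφcont.tendsto x).eventually (eventually_mem_component_iff hK (x₀ := x₀) hx))] with t ht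
      simp only [hf, ht]
    · rw [sub_self, Finset.sum_eq_zero]
      intro i _
      have hne : φ x ≠ p i := fun h => hx (h ▸ hpK i)
      simp [hne]

end Star

/-! ### Segment networks: contours are conserved at every point -/

/-- Finitely many points of the plane and segments between them that meet only in these points. -/
structure SegmentNetwork (ι : Type*) where
  a : ι → ℂ
  b : ι → ℂ
  points : Set ℂ
  points_finite : points.Finite
  a_ne_b : ∀ i, a i ≠ b i
  a_mem : ∀ i, a i ∈ points
  b_mem : ∀ i, b i ∈ points
  points_notMem : ∀ x ∈ points, ∀ i, x ∉ openSegment ℝ (a i) (b i)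
  disjoint : ∀ i j, i ≠ j → Disjoint (openSegment ℝ (a i) (b i)) (openSegment ℝ (a j) (b j))

namespace SegmentNetwork

variable {ι : Type*} (N : SegmentNetwork ι)

/-- The set of all points of the network. -/
def support : Set ℂ := N.points ∪ ⋃ i, segment ℝ (N.a i) (N.b i)

/-- The component of the complement of the network that contains `x`. -/
def face (x : ℂ) : Set ℂ := connectedComponentIn N.supportᶜ x

open scoped Classical in
/-- The algebraic number of times that the contour of `f` passes the segment `i`. -/
noncomputable def jump (f : Set ℂ) (i : ι) : ℝ :=
  (if ∃ p ∈ openSegment ℝ (N.a i) (N.b i), SideMem f p (N.b i - N.a i) then 1 else 0)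
    - (if ∃ p ∈ openSegment ℝ (N.a i) (N.b i), SideMem f p (-(N.b i - N.a i)) then 1 else 0)

variable {N}

theorem mem_segment_iff {i : ι} {x : ℂ} : x ∈ segment ℝ (N.a i) (N.b i) ↔
    x = N.a i ∨ x = N.b i ∨ x ∈ openSegment ℝ (N.a i) (N.b i) := by
  rw [← insert_endpoints_openSegment]; simp

theorem mem_support {x : ℂ} :
    x ∈ N.support ↔ x ∈ N.points ∨ ∃ i, x ∈ openSegment ℝ (N.a i) (N.b i) := by
  simp only [support, Set.mem_union, Set.mem_iUnion]
  constructor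
  · rintro (h | ⟨i, h⟩)
    · exact Or.inl h
    · rcases mem_segment_iff.1 h with rfl | rfl | h
      · exact Or.inl (N.a_mem i)
      · exact Or.inl (N.b_mem i)
      · exact Or.inr ⟨i, h⟩
  · rintro (h | ⟨i, h⟩)
    · exact Or.inl h
    · exact Or.inr ⟨i, openSegment_subset_segment _ _ _ h⟩

theorem isClosed_segment (a b : ℂ) : IsClosed (segment ℝ a b) := by
  rw [← convexHull_pair]
  exact ((Set.finite_singleton b).insert a).isClosed_convexHull ℝ

section Finite

variable [Finite ι]

theorem isClosed_support : IsClosed N.support :=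
  N.points_finite.isClosed.union (isClosed_iUnion_of_finite fun _ => isClosed_segment _ _)

/-- The points and the other segments form a closed set missing `p`, so a small ball sees only
segment `i`. -/
theorem flatAt {i : ι} {p : ℂ} (hp : p ∈ openSegment ℝ (N.a i) (N.b i)) :
    FlatAt N.support p (N.b i - N.a i) := by
  have hcl : IsClosed (N.points ∪ ⋃ j : {j // j ≠ i}, segment ℝ (N.a j) (N.b j)) :=
    N.points_finite.isClosed.union (isClosed_iUnion_of_finite fun _ => isClosed_segment _ _)
  have hpn : p ∉ N.points ∪ ⋃ j : {j // j ≠ i}, segment ℝ (N.a j) (N.b j) := by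
    simp only [Set.mem_union, Set.mem_iUnion, not_or, not_exists]
    refine ⟨fun h => N.points_notMem p h i hp, fun ⟨j, hj⟩ h => ?_⟩
    rcases mem_segment_iff.1 h with rfl | rfl | h
    · exact N.points_notMem _ (N.a_mem j) i hp
    · exact N.points_notMem _ (N.b_mem j) i hp
    · exact Set.disjoint_left.1 (N.disjoint j i hj) h hp
  obtain ⟨η, hη, hball⟩ := Metric.isOpen_iff.1 hcl.isOpen_compl p hpn
  refine ⟨η, hη, fun x hx hxK => ?_⟩
  have hxn := hball hx
  simp only [Set.mem_compl_iff, Set.mem_union, Set.mem_iUnion, not_or, not_exists] at hxn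
  rcases hxK with h | h
  · exact absurd h hxn.1
  · obtain ⟨j, hj⟩ := Set.mem_iUnion.1 h
    by_cases hji : j = i
    · subst hji
      exact im_sub_mul_conj_eq_zero (openSegment_subset_segment _ _ _ hp) hj
    · exact absurd hj (hxn.2 ⟨j, hji⟩)

theorem exists_sideMem_iff {i : ι} {p x₀ d : ℂ} (hp : p ∈ openSegment ℝ (N.a i) (N.b i))
    (hd : d = N.b i - N.a i ∨ d = -(N.b i - N.a i)) :
    (∃ q ∈ openSegment ℝ (N.a i) (N.b i), SideMem (N.face x₀) q d) ↔ SideMem (N.face x₀) p d := by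
  have hne : N.b i - N.a i ≠ 0 := sub_ne_zero.2 (N.a_ne_b i).symm
  have hd0 : d ≠ 0 := by rcases hd with rfl | rfl <;> simpa [-neg_sub] using hne
  have hflat : ∀ q ∈ openSegment ℝ (N.a i) (N.b i), FlatAt N.support q d := by
    rcases hd with rfl | rfl
    · exact fun q hq => flatAt hq
    · exact fun q hq => (flatAt hq).neg
  constructor
  · rintro ⟨q, hq, h⟩
    exact (sideMem_iff_of_mem_openSegment hd0 hd hflat hq hp).1 h
  · exact fun h => ⟨p, hp, h⟩

open scoped Classical in
theorem jump_eq {i : ι} {p : ℂ} (x₀ : ℂ) (hp : p ∈ openSegment ℝ (N.a i) (N.b i)) :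
    N.jump (N.face x₀) i = (if SideMem (N.face x₀) p (N.b i - N.a i) then 1 else 0)
      - (if SideMem (N.face x₀) p (-(N.b i - N.a i)) then 1 else 0) := by
  rw [jump, exists_sideMem_iff hp (Or.inl rfl), exists_sideMem_iff hp (Or.inr rfl)]

/-- Everything not incident to `c` is closed and misses `c`, so small circles avoid it; a radius
below all segment lengths makes the circle cross each incident segment. -/
theorem exists_radius (N : SegmentNetwork ι) (c : ℂ) (hc : c ∈ N.points) :
    ∃ r > 0, (∀ i, r < ‖N.b i - N.a i‖) ∧
      ∀ x ∈ N.support, dist x c = r →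
        ∃ i, (N.a i = c ∨ N.b i = c) ∧ x ∈ openSegment ℝ (N.a i) (N.b i) := by
  have hcl : IsClosed ((N.points \ {c}) ∪
      ⋃ j : {j // ¬ (N.a j = c ∨ N.b j = c)}, segment ℝ (N.a j) (N.b j)) :=
    (N.points_finite.subset Set.sdiff_subset).isClosed.union
      (isClosed_iUnion_of_finite fun _ => isClosed_segment _ _)
  have hcn : c ∉ (N.points \ {c}) ∪
      ⋃ j : {j // ¬ (N.a j = c ∨ N.b j = c)}, segment ℝ (N.a j) (N.b j) := by
    simp only [Set.mem_union, Set.mem_iUnion, not_or, not_exists]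
    refine ⟨fun h => h.2 rfl, fun ⟨j, hj⟩ h => ?_⟩
    push Not at hj
    rcases mem_segment_iff.1 h with h | h | h
    · exact hj.1 h.symm
    · exact hj.2 h.symm
    · exact N.points_notMem c hc j h
  obtain ⟨η, hη, hball⟩ := Metric.isOpen_iff.1 hcl.isOpen_compl c hcn
  have hev : ∀ᶠ r : ℝ in 𝓝[>] 0, 0 < r ∧ r < η ∧ ∀ i, r < ‖N.b i - N.a i‖ := by
    refine Filter.Eventually.and self_mem_nhdsWithin
      (Filter.Eventually.and ?_ (Filter.eventually_all.2 fun i => ?_))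
    · exact mem_nhdsWithin_of_mem_nhds (Iio_mem_nhds hη)
    · exact mem_nhdsWithin_of_mem_nhds
        (Iio_mem_nhds (norm_pos_iff.2 (sub_ne_zero.2 (N.a_ne_b i).symm)))
  obtain ⟨r, hr, hrη, hri⟩ := hev.exists
  refine ⟨r, hr, hri, fun x hx hxr => ?_⟩
  have hxn := hball (show x ∈ Metric.ball c η by rw [Metric.mem_ball, hxr]; exact hrη)
  simp only [Set.mem_compl_iff, Set.mem_union, Set.mem_iUnion, not_or, not_exists] at hxn
  have hxc : x ≠ c := by
    rintro rfl
    rw [dist_self] at hxr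
    exact hr.ne hxr
  rcases mem_support.1 hx with h | ⟨i, h⟩
  · exact absurd ⟨h, hxc⟩ hxn.1
  · refine ⟨i, ?_, h⟩
    by_contra hi
    exact hxn.2 ⟨i, hi⟩ (openSegment_subset_segment _ _ _ h)

end Finite

theorem spoke_mem_openSegment {c d : ℂ} {r : ℝ} (hr : 0 < r) (hrd : r < ‖d - c‖) :
    c + r * Complex.exp ((d - c).arg * Complex.I) ∈ openSegment ℝ c d := by
  rw [openSegment_eq_image']
  have hpos : 0 < ‖d - c‖ := hr.trans hrd
  refine ⟨r / ‖d - c‖, ⟨by positivity, (div_lt_one hpos).2 hrd⟩, ?_⟩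
  have h := Complex.norm_mul_exp_arg_mul_I (d - c)
  have hne : (‖d - c‖ : ℂ) ≠ 0 := by exact_mod_cast hpos.ne'
  simp only [Complex.real_smul]
  conv_lhs => rw [← h]
  simp only [Complex.norm_mul, Complex.norm_real, norm_norm, Complex.norm_exp_ofReal_mul_I, mul_one]
  push_cast
  field_simp

theorem eq_spoke_of_mem_openSegment {c d x : ℂ} {r : ℝ} (hx : x ∈ openSegment ℝ c d)
    (hxr : dist x c = r) : x = c + r * Complex.exp ((d - c).arg * Complex.I) := by
  rw [openSegment_eq_image'] at hx
  obtain ⟨t, ht, rfl⟩ := hx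
  have h := Complex.norm_mul_exp_arg_mul_I (d - c)
  have hr : r = t * ‖d - c‖ := by
    rw [← hxr, dist_eq_norm, add_sub_cancel_left, norm_smul, Real.norm_eq_abs, abs_of_pos ht.1]
  simp only [hr, Complex.real_smul, Complex.ofReal_mul, mul_assoc, h]

open scoped Classical in
/-- The contour of a component of the complement of the network enters every point as often as it
leaves it. -/
theorem sum_jump_eq [Fintype ι] (N : SegmentNetwork ι) (x₀ : ℂ) {c : ℂ} (hc : c ∈ N.points) :
    (∑ i, if N.b i = c then N.jump (N.face x₀) i else 0)
      = ∑ i, if N.a i = c then N.jump (N.face x₀) i else 0 := by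
  obtain ⟨r, hr, hri, hrK⟩ := N.exists_radius c hc
  -- The spokes are the segments starting at `c` and those ending at `c`. Since `w` points outward,
  -- it reverses the latter, and they enter the star sum with `-jump`.
  let seg : {i // N.a i = c} ⊕ {i // N.b i = c} → ι := Sum.elim Subtype.val Subtype.val
  let w : {i // N.a i = c} ⊕ {i // N.b i = c} → ℂ :=
    Sum.elim (fun i => N.b i - N.a i) (fun i => N.a i - N.b i)
  let p : {i // N.a i = c} ⊕ {i // N.b i = c} → ℂ :=
    fun k => c + r * Complex.exp ((w k).arg * Complex.I)
  have hpseg : ∀ k, p k ∈ openSegment ℝ (N.a (seg k)) (N.b (seg k)) := by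
    rintro (⟨i, rfl⟩ | ⟨i, rfl⟩)
    · exact spoke_mem_openSegment hr (hri i)
    · simp only [seg, p, w, Sum.elim_inr]
      rw [openSegment_symm]
      exact spoke_mem_openSegment hr (by rw [norm_sub_rev]; exact hri i)
  have hinj : Function.Injective p := by
    intro k l hkl
    have hseg : seg k = seg l := by
      by_contra hne
      exact Set.disjoint_left.1 (N.disjoint _ _ hne) (hpseg k) (hkl ▸ hpseg l)
    rcases k with ⟨i, hi⟩ | ⟨i, hi⟩ <;> rcases l with ⟨j, hj⟩ | ⟨j, hj⟩ <;>
      simp only [seg, Sum.elim_inl, Sum.elim_inr] at hseg <;> subst hseg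
    · rfl
    · exact absurd (hi.trans hj.symm) (N.a_ne_b i)
    · exact absurd (hj.trans hi.symm) (N.a_ne_b i)
    · rfl
  have hstar := sum_side_star_eq_zero (x₀ := x₀) N.isClosed_support hr (w := w) (p := p) ?_
    (fun _ => rfl) hinj ?_ ?_ ?_
  · rw [Fintype.sum_sum_type] at hstar
    have h1 : ∀ k : {i // N.a i = c}, ((if SideMem (connectedComponentIn N.supportᶜ x₀)
        (p (Sum.inl k)) (w (Sum.inl k)) then (1 : ℝ) else 0)
        - (if SideMem (connectedComponentIn N.supportᶜ x₀) (p (Sum.inl k)) (-w (Sum.inl k))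
          then (1 : ℝ) else 0)) = N.jump (N.face x₀) k := fun k =>
      (jump_eq x₀ (hpseg (Sum.inl k))).symm
    have h2 : ∀ k : {i // N.b i = c}, ((if SideMem (connectedComponentIn N.supportᶜ x₀)
        (p (Sum.inr k)) (w (Sum.inr k)) then (1 : ℝ) else 0)
        - (if SideMem (connectedComponentIn N.supportᶜ x₀) (p (Sum.inr k)) (-w (Sum.inr k))
          then (1 : ℝ) else 0)) = -N.jump (N.face x₀) k := by
      intro k
      have := jump_eq x₀ (hpseg (Sum.inr k))
      simp only [seg, Sum.elim_inr] at this
      rw [this]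
      simp only [w, Sum.elim_inr, neg_sub, face]
      congr
    simp only [h1, h2, Finset.sum_neg_distrib] at hstar
    rw [← Finset.sum_filter, ← Finset.sum_filter,
      Finset.sum_subtype (p := fun i => N.b i = c) _ (by simp),
      Finset.sum_subtype (p := fun i => N.a i = c) _ (by simp)]
    linarith
  · rintro (⟨i, hi⟩ | ⟨i, hi⟩)
    · exact sub_ne_zero.2 (N.a_ne_b i).symm
    · exact sub_ne_zero.2 (N.a_ne_b i)
  · exact fun k => mem_support.2 (Or.inr ⟨_, hpseg k⟩)
  · rintro (⟨i, hi⟩ | ⟨i, hi⟩)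
    · exact flatAt (hpseg (Sum.inl ⟨i, hi⟩))
    · have := (flatAt (hpseg (Sum.inr ⟨i, hi⟩))).neg
      rwa [neg_sub] at this
  · intro x hx hxr
    obtain ⟨i, hi, hxi⟩ := hrK x hx hxr
    rcases hi with rfl | rfl
    · exact ⟨Sum.inl ⟨i, rfl⟩, eq_spoke_of_mem_openSegment hxi hxr⟩
    · rw [openSegment_symm] at hxi
      exact ⟨Sum.inr ⟨i, rfl⟩, eq_spoke_of_mem_openSegment hxi hxr⟩

end SegmentNetwork

/-! ### Winding numbers: bounded contours detect all cycles -/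

namespace SegmentNetwork

open Filter

/-- If the quotient were a real `q ≤ 0`, solving `b - x = q * (a - x)` for `x` would give a convex
combination of `a` and `b`. So the principal logarithm is smooth off the segment. -/
theorem div_mem_slitPlane {a b x : ℂ} (hx : x ∉ segment ℝ a b) :
    (b - x) / (a - x) ∈ Complex.slitPlane := by
  have hax : a - x ≠ 0 := fun h => hx (by rw [← sub_eq_zero.1 h]; exact left_mem_segment ℝ a b)
  by_contra hq
  rw [Complex.mem_slitPlane_iff, not_or, not_lt, not_not] at hq
  obtain ⟨hre, him⟩ := hq
  set q := (b - x) / (a - x) with hqdef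
  have hqs : q = (q.re : ℂ) := Complex.ext (by simp) (by simp [him])
  have hb : b - x = q.re * (a - x) := by rw [← hqs, hqdef, div_mul_cancel₀ _ hax]
  have hs : 0 < 1 - q.re := by linarith
  have hs' : ((1 - q.re : ℝ) : ℂ) ≠ 0 := by exact_mod_cast hs.ne'
  apply hx
  refine ⟨-q.re / (1 - q.re), 1 / (1 - q.re), div_nonneg (by linarith) hs.le, by positivity,
    by field_simp; ring, ?_⟩
  simp only [Complex.real_smul, Complex.ofReal_div]
  field_simp
  push_cast
  linear_combination hb

theorem hasDerivAt_log_div {a b x : ℂ} (hx : x ∉ segment ℝ a b) :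
    HasDerivAt (fun x => Complex.log ((b - x) / (a - x))) ((a - x)⁻¹ - (b - x)⁻¹) x := by
  have hax : a - x ≠ 0 := fun h => hx (by rw [← sub_eq_zero.1 h]; exact left_mem_segment ℝ a b)
  have hbx : b - x ≠ 0 := fun h => hx (by rw [← sub_eq_zero.1 h]; exact right_mem_segment ℝ a b)
  have h : HasDerivAt (fun y => Complex.log ((b - y) / (a - y))) _ x :=
    (HasDerivAt.fun_div ((hasDerivAt_id' x).const_sub b) ((hasDerivAt_id' x).const_sub a) hax).clog
      (div_mem_slitPlane hx)
  convert h using 1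
  field_simp
  ring

theorem tendsto_log_div_cobounded (a b : ℂ) :
    Tendsto (fun x => Complex.log ((b - x) / (a - x))) (Bornology.cobounded ℂ) (𝓝 0) := by
  have h1 : Tendsto (fun x : ℂ => a - x) (Bornology.cobounded ℂ) (Bornology.cobounded ℂ) := by
    simp
  have h2 : Tendsto (fun x : ℂ => 1 + (b - a) * (a - x)⁻¹) (Bornology.cobounded ℂ) (𝓝 1) := by
    simpa using ((tendsto_inv₀_cobounded.comp h1).const_mul (b - a)).const_add 1
  have h3 : Tendsto (fun x : ℂ => (b - x) / (a - x)) (Bornology.cobounded ℂ) (𝓝 1) := by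
    refine h2.congr' ?_
    filter_upwards [h1.eventually (Bornology.eventually_ne_cobounded 0)] with x hx
    field_simp
    ring
  have h4 := (continuousAt_clog Complex.one_mem_slitPlane).tendsto
  rw [Complex.log_one] at h4
  exact h4.comp h3

/-- Across a segment the angle under which it is seen jumps by `2 * π`. -/
theorem tendsto_arg_left {a b p : ℂ} (hp : p ∈ openSegment ℝ a b) (hab : a ≠ b) :
    Tendsto (fun ε : ℝ => ((b - (p + (ε : ℂ) * (Complex.I * (b - a)))) /
      (a - (p + (ε : ℂ) * (Complex.I * (b - a))))).arg) (𝓝[>] 0) (𝓝 Real.pi) ∧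
    Tendsto (fun ε : ℝ => ((b - (p + (ε : ℂ) * (Complex.I * -(b - a)))) /
      (a - (p + (ε : ℂ) * (Complex.I * -(b - a))))).arg) (𝓝[>] 0) (𝓝 (-Real.pi)) := by
  rw [openSegment_eq_image'] at hp
  obtain ⟨t, ht, rfl⟩ := hp
  have hd : b - a ≠ 0 := sub_ne_zero.2 hab.symm
  have ht0 : t ≠ 0 := ht.1.ne'
  -- This is the quotient after cancelling `b - a`. It crosses the branch cut at `q 0 < 0`, and its
  -- imaginary part has the sign of `ε`, which gives the limits `π` and `-π`.
  set q : ℝ → ℂ := fun ε => ((1 - t) - ε * Complex.I) / (-t - ε * Complex.I) with hq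
  have hquot : ∀ ε : ℝ, (b - (a + t • (b - a) + (ε : ℂ) * (Complex.I * (b - a)))) /
      (a - (a + t • (b - a) + (ε : ℂ) * (Complex.I * (b - a)))) = q ε := by
    intro ε
    simp only [hq, Complex.real_smul]
    rw [← mul_div_mul_right (1 - (t : ℂ) - ε * Complex.I) _ hd]
    congr 1 <;> ring
  have hquot' : ∀ ε : ℝ, (b - (a + t • (b - a) + (ε : ℂ) * (Complex.I * -(b - a)))) /
      (a - (a + t • (b - a) + (ε : ℂ) * (Complex.I * -(b - a)))) = q (-ε) := by
    intro ε
    rw [← hquot]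
    push_cast
    congr 1 <;> ring
  have hq0 : q 0 = ((-((1 - t) / t) : ℝ) : ℂ) := by
    simp only [hq]
    push_cast
    rw [zero_mul, sub_zero, sub_zero, div_neg]
  have hre : (q 0).re < 0 := by
    rw [hq0, Complex.ofReal_re, neg_lt_zero]
    exact div_pos (by linarith [ht.2]) ht.1
  have him : (q 0).im = 0 := by rw [hq0, Complex.ofReal_im]
  have hqim : ∀ ε, (q ε).im = ε / (t ^ 2 + ε ^ 2) := by
    intro ε
    have h1 : t ^ 2 + ε ^ 2 ≠ 0 := by positivity
    simp only [hq, Complex.div_im, Complex.normSq_apply]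
    simp
    have h2 : t * t + ε * ε ≠ 0 := by rwa [← sq, ← sq]
    field_simp
    ring
  have hqcont : ContinuousAt q 0 := by
    refine ContinuousAt.div (by fun_prop) (by fun_prop) ?_
    simpa using ht0
  simp only [hquot, hquot']
  have hpos : ∀ ε : ℝ, 0 < ε → 0 < ε / (t ^ 2 + ε ^ 2) := fun ε hε => by positivity
  constructor
  · refine (Complex.tendsto_arg_nhdsWithin_im_nonneg_of_re_neg_of_im_zero hre him).comp ?_
    refine tendsto_nhdsWithin_iff.2 ⟨hqcont.tendsto.mono_left nhdsWithin_le_nhds, ?_⟩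
    filter_upwards [self_mem_nhdsWithin] with ε hε
    simp only [hqim]
    exact (hpos ε hε).le
  · refine (Complex.tendsto_arg_nhdsWithin_im_neg_of_re_neg_of_im_zero hre him).comp ?_
    refine tendsto_nhdsWithin_iff.2 ⟨?_, ?_⟩
    · have hneg : Tendsto (fun ε : ℝ => -ε) (𝓝[>] 0) (𝓝 0) := by
        simpa using (continuous_neg.tendsto (0 : ℝ)).mono_left
          (nhdsWithin_le_nhds (s := Set.Ioi (0 : ℝ)))
      exact hqcont.tendsto.comp hneg
    · filter_upwards [self_mem_nhdsWithin] with ε hε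
      simp only [hqim, neg_div, neg_sq, neg_lt_zero]
      exact hpos ε hε

variable {ι : Type*} {N : SegmentNetwork ι}

theorem notMem_segment {x : ℂ} (hx : x ∉ N.support) (i : ι) : x ∉ segment ℝ (N.a i) (N.b i) :=
  fun h => hx (Or.inr (Set.mem_iUnion.2 ⟨i, h⟩))

theorem sideMem_face_iff {p d x y : ℂ} (hyp : SideMem (N.face y) p d) :
    SideMem (N.face x) p d ↔ N.face x = N.face y := by
  constructor
  · intro h
    obtain ⟨ε, h1, h2⟩ := (h.and hyp).exists
    exact (connectedComponentIn_eq h1).trans (connectedComponentIn_eq h2).symm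
  · intro h
    rwa [h]

variable [Fintype ι]

/-- The integral of `∑ i, z i • dw / (w - x)` along the segments of the network. -/
noncomputable def winding (N : SegmentNetwork ι) (z : ι → ℝ) (x : ℂ) : ℂ :=
  ∑ i, (z i : ℂ) * Complex.log ((N.b i - x) / (N.a i - x))

/-- The hypothesis `hz` is the cycle condition tested on point functions. Applied to `w ↦ (w -
x)⁻¹`, it makes the derivative of `winding` vanish on the open connected face. -/
theorem winding_eq {z : ι → ℝ}
    (hz : ∀ g : ℂ → ℂ, ∑ i, (z i : ℂ) * g (N.a i) = ∑ i, (z i : ℂ) * g (N.b i)) {x₀ x y : ℂ}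
    (hx : x ∈ N.face x₀) (hy : y ∈ N.face x₀) : N.winding z x = N.winding z y := by
  have hderiv : ∀ x ∈ N.face x₀, HasDerivAt (N.winding z) 0 x := by
    intro x hx
    have hxK : x ∉ N.support := connectedComponentIn_subset _ _ hx
    have h := HasDerivAt.fun_sum (u := Finset.univ) fun i _ =>
      (hasDerivAt_log_div (notMem_segment hxK i)).const_mul (z i : ℂ)
    have hsum : ∑ i, (z i : ℂ) * ((N.a i - x)⁻¹ - (N.b i - x)⁻¹) = 0 := by
      simp only [mul_sub, Finset.sum_sub_distrib]
      rw [hz fun w => (w - x)⁻¹, sub_self]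
    rw [hsum] at h
    exact h
  refine IsOpen.is_const_of_deriv_eq_zero (s := N.face x₀)
    N.isClosed_support.isOpen_compl.connectedComponentIn isPreconnected_connectedComponentIn
    (fun x hx => (hderiv x hx).differentiableAt.differentiableWithinAt)
    (fun x hx => (hderiv x hx).deriv) hx hy

/-- An unbounded face reaches infinity, where every logarithm tends to `0`, and `winding` is
constant on the face. -/
theorem winding_eq_zero {z : ι → ℝ}
    (hz : ∀ g : ℂ → ℂ, ∑ i, (z i : ℂ) * g (N.a i) = ∑ i, (z i : ℂ) * g (N.b i)) {x₀ x : ℂ}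
    (hx : x ∈ N.face x₀) (hunb : ¬ Bornology.IsBounded (N.face x₀)) : N.winding z x = 0 := by
  have hlim : Tendsto (N.winding z) (Bornology.cobounded ℂ) (𝓝 0) := by
    have h := tendsto_finsetSum (Finset.univ : Finset ι) fun i _ =>
      (tendsto_log_div_cobounded (N.a i) (N.b i)).const_mul (z i : ℂ)
    simp only [mul_zero, Finset.sum_const_zero] at h
    exact h
  have hne : (Bornology.cobounded ℂ ⊓ 𝓟 (N.face x₀)).NeBot := by
    rw [inf_principal_neBot_iff]
    intro u hu
    by_contra hcon
    rw [Set.not_nonempty_iff_eq_empty] at hcon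
    apply hunb
    have hu' : Bornology.IsBounded uᶜ := by rwa [Bornology.isBounded_def, compl_compl]
    exact hu'.subset fun y hy hyu => by
      have : y ∈ u ∩ N.face x₀ := ⟨hyu, hy⟩
      rw [hcon] at this
      exact this
  refine tendsto_nhds_unique (f := N.winding z) (l := Bornology.cobounded ℂ ⊓ 𝓟 (N.face x₀)) ?_ (
    hlim.mono_left inf_le_left)
  refine tendsto_const_nhds.congr' ?_
  filter_upwards [mem_inf_of_right (mem_principal_self (N.face x₀))] with y hy
  exact winding_eq hz hx hy

/-- Only the term of segment `i` is discontinuous at `p`; the differences of the other terms tend to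
`0`. -/
theorem winding_jump {z : ι → ℝ}
    (hz : ∀ g : ℂ → ℂ, ∑ i, (z i : ℂ) * g (N.a i) = ∑ i, (z i : ℂ) * g (N.b i)) {i : ι}
    {p x y : ℂ} (hp : p ∈ openSegment ℝ (N.a i) (N.b i)) (hx : x ∉ N.support) (hy : y ∉ N.support)
    (hxp : SideMem (N.face x) p (N.b i - N.a i)) (hyp : SideMem (N.face y) p (-(N.b i - N.a i))) :
    (N.winding z x).im - (N.winding z y).im = 2 * Real.pi * z i := by
  classical
  have hterm : ∀ j, Tendsto (fun ε : ℝ =>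
      z j * ((N.b j - (p + (ε : ℂ) * (Complex.I * (N.b i - N.a i)))) /
        (N.a j - (p + (ε : ℂ) * (Complex.I * (N.b i - N.a i))))).arg
      - z j * ((N.b j - (p + (ε : ℂ) * (Complex.I * -(N.b i - N.a i)))) /
        (N.a j - (p + (ε : ℂ) * (Complex.I * -(N.b i - N.a i))))).arg) (𝓝[>] 0)
      (𝓝 (if j = i then 2 * Real.pi * z i else 0)) := by
    intro j
    split_ifs with hji
    · subst hji
      obtain ⟨h1, h2⟩ := tendsto_arg_left hp (N.a_ne_b j)
      have := (h1.const_mul (z j)).sub (h2.const_mul (z j))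
      convert this using 2
      ring
    · have hpj : p ∉ segment ℝ (N.a j) (N.b j) := by
        intro h
        rcases mem_segment_iff.1 h with rfl | rfl | h
        · exact N.points_notMem _ (N.a_mem j) i hp
        · exact N.points_notMem _ (N.b_mem j) i hp
        · exact Set.disjoint_left.1 (N.disjoint j i hji) h hp
      have hc : ContinuousAt (fun x => Complex.log ((N.b j - x) / (N.a j - x))) p :=
        (hasDerivAt_log_div hpj).continuousAt
      have hc' := Complex.continuous_im.continuousAt.comp hc
      have h1 := ((hc'.tendsto.comp (tendsto_step p (N.b i - N.a i))).const_mul (z j)).sub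
        ((hc'.tendsto.comp (tendsto_step p (-(N.b i - N.a i)))).const_mul (z j))
      rw [sub_self] at h1
      simpa only [Function.comp_def, Complex.log_im] using h1
  have hsum := tendsto_finsetSum (Finset.univ : Finset ι) fun j _ => hterm j
  rw [Finset.sum_ite_eq' Finset.univ i, if_pos (Finset.mem_univ i)] at hsum
  refine tendsto_nhds_unique (tendsto_const_nhds.congr' ?_) hsum
  filter_upwards [hxp, hyp] with ε h1 h2
  rw [winding_eq hz (mem_connectedComponentIn hx) h1, winding_eq hz (mem_connectedComponentIn hy) h2]
  simp only [winding, Complex.im_sum, Complex.im_ofReal_mul, Complex.log_im,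
    Finset.sum_sub_distrib]

theorem exists_sideMem_face {i : ι} {p d : ℂ} (hp : p ∈ openSegment ℝ (N.a i) (N.b i))
    (hd : d = N.b i - N.a i ∨ d = -(N.b i - N.a i)) :
    ∃ x ∉ N.support, SideMem (N.face x) p d := by
  have hne : N.b i - N.a i ≠ 0 := sub_ne_zero.2 (N.a_ne_b i).symm
  have hd0 : d ≠ 0 := by rcases hd with rfl | rfl <;> simpa [-neg_sub] using hne
  have hflat : FlatAt N.support p d := by
    rcases hd with rfl | rfl
    · exact flatAt hp
    · exact (flatAt hp).neg
  obtain ⟨η, hη, hsub, -⟩ := hflat.exists_halfBall (x₀ := p)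
  have hev := eventually_mem_halfBall hd0 (Metric.mem_ball_self hη (x := p)) (by simp)
  obtain ⟨ε, hε⟩ := hev.exists
  exact ⟨_, hsub hε, hev.mono fun ε' hε' =>
    (convex_halfBall p d η).isPreconnected.subset_connectedComponentIn hε hsub hε'⟩

/-- A vector orthogonal to the contours of all bounded components of the complement is orthogonal to
all cycles. -/
theorem sum_mul_cycle_eq_zero {z y : ι → ℝ}
    (hz : ∀ g : ℂ → ℂ, ∑ i, (z i : ℂ) * g (N.a i) = ∑ i, (z i : ℂ) * g (N.b i))
    (hy : ∀ x ∉ N.support, Bornology.IsBounded (N.face x) →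
      ∑ i, N.jump (N.face x) i * y i = 0) :
    ∑ i, z i * y i = 0 := by
  classical
  have hmid : ∀ i, ∃ p, p ∈ openSegment ℝ (N.a i) (N.b i) := fun i =>
    ⟨_, midpoint_mem_openSegment _ _⟩
  choose p hp using hmid
  choose xl hxl hl using fun i => exists_sideMem_face (hp i) (Or.inl rfl)
  choose xr hxr hr using fun i => exists_sideMem_face (hp i) (Or.inr rfl)
  -- The value of the winding on a face, independent of the chosen point by `winding_eq`; the
  -- default `0` is taken only at sets that are not faces.
  set ω : Set ℂ → ℝ := fun f =>
    if h : ∃ x, x ∉ N.support ∧ f = N.face x then (N.winding z h.choose).im else 0 with hωdef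
  have hω : ∀ x ∉ N.support, ω (N.face x) = (N.winding z x).im := by
    intro x hx
    have hex : ∃ y, y ∉ N.support ∧ N.face x = N.face y := ⟨x, hx, rfl⟩
    simp only [hωdef, dif_pos hex]
    rw [winding_eq (x₀ := x) hz _ (mem_connectedComponentIn hx)]
    have := mem_connectedComponentIn (F := N.supportᶜ) hex.choose_spec.1
    exact hex.choose_spec.2.symm.subset this
  have hzi : ∀ i, 2 * Real.pi * z i = ω (N.face (xl i)) - ω (N.face (xr i)) := by
    intro i
    rw [hω _ (hxl i), hω _ (hxr i), winding_jump hz (hp i) (hxl i) (hxr i) (hl i) (hr i)]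
  have hjump : ∀ x i, N.jump (N.face x) i
      = (if N.face x = N.face (xl i) then 1 else 0)
        - (if N.face x = N.face (xr i) then 1 else 0) := by
    intro x i
    rw [jump_eq x (hp i)]
    simp only [sideMem_face_iff (hl i), sideMem_face_iff (hr i)]
  -- The faces adjacent to some segment suffice, so finiteness of the set of all faces is not
  -- needed.
  set F : Finset (Set ℂ) := Finset.univ.image (fun i => N.face (xl i)) ∪
    Finset.univ.image (fun i => N.face (xr i)) with hF
  have hlF : ∀ i, N.face (xl i) ∈ F := fun i => by simp [hF]
  have hrF : ∀ i, N.face (xr i) ∈ F := fun i => by simp [hF]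
  have hFface : ∀ f ∈ F, ∃ x, x ∉ N.support ∧ f = N.face x := by
    intro f hf
    simp only [hF, Finset.mem_union, Finset.mem_image, Finset.mem_univ, true_and] at hf
    rcases hf with ⟨i, rfl⟩ | ⟨i, rfl⟩
    · exact ⟨_, hxl i, rfl⟩
    · exact ⟨_, hxr i, rfl⟩
  have hzF : ∀ i, 2 * Real.pi * z i = ∑ f ∈ F, ω f * N.jump f i := by
    intro i
    have h1 : ∀ f ∈ F, ω f * N.jump f i = (if f = N.face (xl i) then ω f else 0)
        - (if f = N.face (xr i) then ω f else 0) := by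
      intro f hf
      obtain ⟨x, -, rfl⟩ := hFface f hf
      rw [hjump, mul_sub, mul_ite, mul_ite, mul_one, mul_zero]
    rw [Finset.sum_congr rfl h1, Finset.sum_sub_distrib, Finset.sum_ite_eq', Finset.sum_ite_eq',
      if_pos (hlF i), if_pos (hrF i), hzi]
  have hmain : 2 * Real.pi * ∑ i, z i * y i = 0 := by
    calc 2 * Real.pi * ∑ i, z i * y i = ∑ i, ∑ f ∈ F, ω f * (N.jump f i * y i) := by
          rw [Finset.mul_sum]
          refine Finset.sum_congr rfl fun i _ => ?_
          rw [← mul_assoc, hzF, Finset.sum_mul]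
          exact Finset.sum_congr rfl fun f _ => mul_assoc _ _ _
      _ = ∑ f ∈ F, ω f * ∑ i, N.jump f i * y i := by
          rw [Finset.sum_comm]
          exact Finset.sum_congr rfl fun f _ => (Finset.mul_sum _ _ _).symm
      _ = 0 := by
          refine Finset.sum_eq_zero fun f hf => ?_
          obtain ⟨x, hx, rfl⟩ := hFface f hf
          by_cases hb : Bornology.IsBounded (N.face x)
          · rw [hy x hx hb, mul_zero]
          · rw [hω x hx, winding_eq_zero hz (mem_connectedComponentIn hx) hb, Complex.zero_im,
              zero_mul]
  exact (mul_eq_zero.1 hmain).resolve_left (by positivity)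

end SegmentNetwork

/-! ### From segments back to polygonal edges -/

namespace PolygonalArc

theorem first_ne_last (γ : PolygonalArc) : γ.first ≠ γ.last :=
  fun h => absurd (γ.corner_injective h) (Fin.last_pos.ne)

theorem openSegment_subset_inner (γ : PolygonalArc) (i : Fin (γ.n + 1)) :
    openSegment ℝ (γ.corner i.castSucc) (γ.corner i.succ) ⊆ γ.inner := by
  intro x hx
  refine ⟨Set.mem_iUnion.2 ⟨i, openSegment_subset_segment _ _ _ hx⟩, ?_⟩
  rintro (rfl | rfl)
  · exact γ.corner_notMem _ _ hx
  · exact γ.corner_notMem _ _ hx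

theorem corner_mem_carrier (γ : PolygonalArc) (j : Fin (γ.n + 2)) : γ.corner j ∈ γ.carrier := by
  refine Fin.cases ?_ (fun i => ?_) j
  · exact Set.mem_iUnion.2 ⟨0, left_mem_segment ℝ _ _⟩
  · exact Set.mem_iUnion.2 ⟨i, right_mem_segment ℝ _ _⟩

theorem corner_mem_inner (γ : PolygonalArc) (j : Fin γ.n) :
    γ.corner j.succ.castSucc ∈ γ.inner := by
  refine ⟨γ.corner_mem_carrier _, ?_⟩
  rintro (h | h)
  · have := γ.corner_injective h
    simp [Fin.ext_iff] at this
  · have := γ.corner_injective h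
    simp only [Fin.ext_iff, Fin.val_castSucc, Fin.val_succ, Fin.val_last] at this
    omega

end PolygonalArc

namespace PlaneMultigraph

variable {V E : Type*}

theorem src_ne_tgt (G : PlaneMultigraph V E) (e : E) : G.src e ≠ G.tgt e := by
  intro h
  apply (G.arc e).first_ne_last
  rw [G.arc_first, G.arc_last, h]

open scoped Classical in
/-- At every vertex the incoming and the outgoing values of `z` have the same sum. -/
def IsCycle [Fintype E] (G : PlaneMultigraph V E) (z : E → ℝ) : Prop :=
  ∀ v : V, (∑ e : E, if G.tgt e = v then z e else 0) = ∑ e : E, if G.src e = v then z e else 0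

/-- The segments of all edges of a plane multigraph. -/
def network [Finite V] [Finite E] (G : PlaneMultigraph V E) :
    SegmentNetwork (Σ e : E, Fin ((G.arc e).n + 1)) where
  a s := (G.arc s.1).corner s.2.castSucc
  b s := (G.arc s.1).corner s.2.succ
  points := Set.range G.pos ∪ ⋃ e, Set.range (G.arc e).corner
  points_finite := (Set.finite_range _).union (Set.finite_iUnion fun _ => Set.finite_range _)
  a_ne_b s h := (Fin.castSucc_lt_succ (i := s.2)).ne ((G.arc s.1).corner_injective h)
  a_mem s := Or.inr (Set.mem_iUnion.2 ⟨s.1, Set.mem_range_self _⟩)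
  b_mem s := Or.inr (Set.mem_iUnion.2 ⟨s.1, Set.mem_range_self _⟩)
  points_notMem := by
    rintro x (⟨v, rfl⟩ | hx) ⟨e, i⟩ hxs
    · exact G.vertex_notMem e v ((G.arc e).openSegment_subset_inner i hxs)
    · obtain ⟨e', j, rfl⟩ := Set.mem_iUnion.1 hx
      by_cases he : e = e'
      · subst he
        exact (G.arc e).corner_notMem i j hxs
      · exact Set.disjoint_left.1 (G.edges_disjoint e e' he)
          ((G.arc e).openSegment_subset_inner i hxs) ((G.arc e').corner_mem_carrier j)
  disjoint := by
    rintro ⟨e, i⟩ ⟨e', i'⟩ hne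
    by_cases he : e = e'
    · subst he
      exact (G.arc e).segments_disjoint i i' fun h => hne (by rw [h])
    · exact (G.edges_disjoint e e' he).mono ((G.arc e).openSegment_subset_inner i)
        (((G.arc e').openSegment_subset_inner i').trans Set.sdiff_subset)

theorem support_network [Finite V] [Finite E] (G : PlaneMultigraph V E) :
    G.network.support = G.support := by
  ext x
  simp only [SegmentNetwork.support, support, network, PolygonalArc.carrier, Set.mem_union,
    Set.mem_iUnion, Set.mem_range, Sigma.exists]
  constructor
  · rintro ((h | ⟨e, j, rfl⟩) | ⟨e, i, h⟩)
    · exact Or.inl h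
    · exact Or.inr ⟨e, Set.mem_iUnion.1 ((G.arc e).corner_mem_carrier j)⟩
    · exact Or.inr ⟨e, i, h⟩
  · rintro (h | ⟨e, i, h⟩)
    · exact Or.inl (Or.inl h)
    · exact Or.inr ⟨e, i, h⟩

theorem face_network [Finite V] [Finite E] (G : PlaneMultigraph V E) (x : ℂ) :
    G.network.face x = connectedComponentIn G.supportᶜ x := by
  rw [SegmentNetwork.face, support_network]

theorem sum_sub_castSucc {R : Type*} [CommRing R] {n : ℕ} (g : Fin (n + 1) → R) :
    ∑ i : Fin n, (g i.succ - g i.castSucc) = g (Fin.last n) - g 0 := by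
  have h1 := Fin.sum_univ_succ g
  have h2 := Fin.sum_univ_castSucc g
  rw [Finset.sum_sub_distrib]
  linear_combination h1.symm.trans h2

/-- Along each edge the sum telescopes, so edge values spread over the segments have the same
boundary; the cycle condition thus passes between graph and network. -/
theorem sum_network_sub {R : Type*} [CommRing R] [Finite V] [Fintype E] (G : PlaneMultigraph V E)
    (x : E → R) (g : ℂ → R) :
    ∑ s, x s.1 * g (G.network.b s) - ∑ s, x s.1 * g (G.network.a s)
      = ∑ e, x e * g (G.pos (G.tgt e)) - ∑ e, x e * g (G.pos (G.src e)) := by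
  rw [← Finset.sum_sub_distrib, ← Finset.sum_sub_distrib, Fintype.sum_sigma]
  refine Finset.sum_congr rfl fun e _ => ?_
  rw [← mul_sub, ← G.arc_first, ← G.arc_last]
  simp only [← mul_sub, ← Finset.mul_sum]
  congr 1
  exact sum_sub_castSucc fun j => g ((G.arc e).corner j)

theorem IsCycle.sum_mul_eq [Finite V] [Fintype E] {G : PlaneMultigraph V E} {z : E → ℝ}
    (hz : G.IsCycle z) (h : V → ℂ) : ∑ e, (z e : ℂ) * h (G.src e) = ∑ e, (z e : ℂ) * h (G.tgt e) := by
  classical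
  have := Fintype.ofFinite V
  have key : ∀ t : E → V, ∑ e, (z e : ℂ) * h (t e)
      = ∑ v, ((∑ e, if t e = v then z e else 0 : ℝ) : ℂ) * h v := by
    intro t
    simp only [Complex.ofReal_sum, Finset.sum_mul]
    rw [Finset.sum_comm]
    refine Finset.sum_congr rfl fun e _ => ?_
    rw [Finset.sum_eq_single (t e)]
    · simp
    · intro v _ hv
      simp [hv.symm]
    · simp
  rw [key, key]
  refine Finset.sum_congr rfl fun v _ => ?_
  have := hz v
  congr 2
  convert this.symm

section Contour

variable [Finite V] [Fintype E] (G : PlaneMultigraph V E)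

/-- At an inner corner exactly one segment ends and one starts, so conservation at that point
equates their jumps. -/
theorem jump_castSucc_eq_jump_succ (x : ℂ) (e : E) (j : Fin (G.arc e).n) :
    G.network.jump (G.network.face x) ⟨e, j.castSucc⟩
      = G.network.jump (G.network.face x) ⟨e, j.succ⟩ := by
  classical
  have hc : (G.arc e).corner j.succ.castSucc ∈ G.network.points :=
    Or.inr (Set.mem_iUnion.2 ⟨e, Set.mem_range_self _⟩)
  have hcorner : ∀ e' j', (G.arc e').corner j' = (G.arc e).corner j.succ.castSucc → e' = e := by
    intro e' j' h
    by_contra hne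
    exact Set.disjoint_left.1 (G.edges_disjoint e e' (Ne.symm hne)) ((G.arc e).corner_mem_inner j)
      (h ▸ (G.arc e').corner_mem_carrier j')
  have h := G.network.sum_jump_eq x hc
  rw [Finset.sum_eq_single ⟨e, j.castSucc⟩, Finset.sum_eq_single ⟨e, j.succ⟩] at h
  · rwa [if_pos (by rfl), if_pos (by rfl)] at h
  · rintro ⟨e', i⟩ _ hne
    refine if_neg fun h => ?_
    obtain rfl := hcorner _ _ h
    apply hne
    exact congrArg (Sigma.mk _) (Fin.castSucc_injective _ ((G.arc e').corner_injective h))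
  · simp
  · rintro ⟨e', i⟩ _ hne
    refine if_neg fun h => ?_
    obtain rfl := hcorner _ _ h
    apply hne
    have h' := (G.arc e').corner_injective h
    rw [Fin.castSucc_succ] at h'
    exact congrArg (Sigma.mk _) (Fin.succ_injective _ h')
  · simp

theorem jump_eq_jump_zero (x : ℂ) (e : E) (i : Fin ((G.arc e).n + 1)) :
    G.network.jump (G.network.face x) ⟨e, i⟩ = G.network.jump (G.network.face x) ⟨e, 0⟩ := by
  induction i using Fin.induction with
  | zero => rfl
  | succ j ih => rw [← jump_castSucc_eq_jump_succ, ih]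

-- This bridges `contour`, which looks for a left side and a right side on possibly different
-- segments, and `jump`, which uses one segment. If both sides occur somewhere, the common
-- difference is both nonnegative and nonpositive, hence `0`.
open scoped Classical in
theorem ite_exists_sub_ite_exists {α : Type*} [Nonempty α] {L R : α → Prop} {d : ℝ}
    (h : ∀ i, (if L i then (1 : ℝ) else 0) - (if R i then 1 else 0) = d) :
    (if ∃ i, L i then (1 : ℝ) else 0) - (if ∃ i, R i then 1 else 0) = d := by
  by_cases hL : ∃ i, L i <;> by_cases hR : ∃ i, R i
  · obtain ⟨i, hi⟩ := hL
    obtain ⟨j, hj⟩ := hR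
    have h1 := h i
    have h2 := h j
    rw [if_pos ⟨i, hi⟩, if_pos ⟨j, hj⟩]
    rw [if_pos hi] at h1
    rw [if_pos hj] at h2
    split_ifs at h1 h2 <;> linarith
  · obtain ⟨i, hi⟩ := hL
    rw [if_pos ⟨i, hi⟩, if_neg hR, ← h i, if_pos hi, if_neg fun h => hR ⟨i, h⟩]
  · obtain ⟨i, hi⟩ := hR
    rw [if_neg hL, if_pos ⟨i, hi⟩, ← h i, if_neg fun h => hL ⟨i, h⟩, if_pos hi]
  · obtain ⟨i⟩ := ‹Nonempty α›
    rw [if_neg hL, if_neg hR, ← h i, if_neg fun h => hL ⟨i, h⟩, if_neg fun h => hR ⟨i, h⟩]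

theorem jump_eq_contour (x : ℂ) (s : Σ e : E, Fin ((G.arc e).n + 1)) :
    G.network.jump (G.network.face x) s = G.contour (G.network.face x) s.1 := by
  classical
  obtain ⟨e, i⟩ := s
  have hright : (G.arc e).HasOnRight (G.network.face x) ↔ ∃ i : Fin ((G.arc e).n + 1),
      ∃ p ∈ openSegment ℝ ((G.arc e).corner i.castSucc) ((G.arc e).corner i.succ),
        SideMem (G.network.face x) p (-((G.arc e).corner i.succ - (G.arc e).corner i.castSucc)) := by
    simp only [PolygonalArc.HasOnRight, SideMem, mul_neg, ← sub_eq_add_neg]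
  refine (ite_exists_sub_ite_exists fun i' =>
    (G.jump_eq_jump_zero x e i').trans (G.jump_eq_jump_zero x e i).symm).symm.trans ?_
  unfold contour
  congr! 2
  exact hright.symm

/-- The contour of a part of the plane is a cycle. -/
theorem isCycle_contour {f : Set ℂ} (hf : f ∈ G.faces) : G.IsCycle (G.contour f) := by
  classical
  obtain ⟨x, -, rfl⟩ := hf
  intro v
  rw [← face_network]
  have h := G.network.sum_jump_eq x (c := G.pos v) (Or.inl (Set.mem_range_self v))
  have h2 := G.sum_network_sub (G.contour (G.network.face x)) fun w => if w = G.pos v then 1 else 0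
  simp only [mul_ite, mul_one, mul_zero, G.pos_injective.eq_iff] at h2
  simp only [jump_eq_contour] at h
  rw [sub_eq_zero.2 (by convert h)] at h2
  convert sub_eq_zero.1 h2.symm

/-- A vector orthogonal to the contours of the bounded parts is orthogonal to all cycles. -/
theorem sum_mul_eq_zero_of_boundedFaces {y z : E → ℝ}
    (hy : ∀ f ∈ G.boundedFaces, ∑ e, G.contour f e * y e = 0) (hz : G.IsCycle z) :
    ∑ e, z e * y e = 0 := by
  classical
  -- The whole value `y e` is placed on the first segment of `e`, so that sums over segments
  -- reproduce sums over edges.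
  have hsum : ∀ u : E → ℝ, ∑ s : (Σ e : E, Fin ((G.arc e).n + 1)),
      u s.1 * (if s.2 = 0 then y s.1 else 0) = ∑ e, u e * y e := by
    intro u
    rw [Fintype.sum_sigma]
    refine Finset.sum_congr rfl fun e _ => ?_
    refine (Finset.sum_eq_single (0 : Fin ((G.arc e).n + 1)) (fun i _ hi => ?_) (by simp)).trans ?_
    · exact (congrArg _ (if_neg hi)).trans (mul_zero _)
    · exact congrArg _ (if_pos rfl)
  rw [← hsum]
  refine G.network.sum_mul_cycle_eq_zero (z := fun s => z s.1) (fun g => ?_) fun x hx hb => ?_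
  · have h := G.sum_network_sub (fun e => (z e : ℂ)) g
    rw [hz.sum_mul_eq fun v => g (G.pos v), sub_self] at h
    exact (sub_eq_zero.1 h).symm
  · simp only [jump_eq_contour]
    rw [hsum]
    refine hy _ ⟨⟨x, ?_, G.face_network x⟩, hb⟩
    rwa [support_network] at hx

end Contour

end PlaneMultigraph

/-! ### Linear algebra on the cycle space -/

namespace PlaneCircuit

variable {V ρ : Type*} [Fintype ρ] (C : PlaneCircuit V ρ)

open scoped Classical in
/-- The currents that satisfy the first Kirchhoff law. -/
def cycleSpace : Submodule ℝ (Option ρ → ℝ) where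
  carrier := {z | C.NodeLaw z}
  zero_mem' v := by simp
  add_mem' {x y} hx hy v := by
    have := congr_arg₂ (· + ·) (hx v) (hy v)
    simp only [← Finset.sum_add_distrib, ← ite_add_zero] at this
    exact this
  smul_mem' c x hx v := by
    have := congr_arg (c * ·) (hx v)
    simp only [Finset.mul_sum, mul_ite, mul_zero] at this
    exact this

/-- The power form `∑ k, R k * z k * I k` of the resistors. -/
noncomputable def power : (Option ρ → ℝ) →ₗ[ℝ] (Option ρ → ℝ) →ₗ[ℝ] ℝ :=
  LinearMap.mk₂ ℝ (fun I z => ∑ k, z (some k) * (I (some k) * C.resistance k))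
    (fun x y z => by
      simp only [← Finset.sum_add_distrib, Pi.add_apply]
      exact Finset.sum_congr rfl fun _ _ => by ring)
    (fun c x z => by
      simp only [Pi.smul_apply, smul_eq_mul, Finset.mul_sum]
      exact Finset.sum_congr rfl fun _ _ => by ring)
    (fun x y z => by
      simp only [← Finset.sum_add_distrib, Pi.add_apply]
      exact Finset.sum_congr rfl fun _ _ => by ring)
    (fun c x z => by
      simp only [Pi.smul_apply, smul_eq_mul, Finset.mul_sum]
      exact Finset.sum_congr rfl fun _ _ => by ring)

theorem power_apply (I z : Option ρ → ℝ) :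
    C.power I z = ∑ k, z (some k) * (I (some k) * C.resistance k) := rfl

/-- Positive resistances make all resistor currents vanish. The battery is absent from the form; its
current vanishes by the node law at its positive pole, which differs from its negative pole. -/
theorem eq_zero_of_power_self_eq_zero {I : Option ρ → ℝ} (hI : C.NodeLaw I)
    (h : C.power I I = 0) : I = 0 := by
  classical
  rw [power_apply] at h
  have hnn : ∀ k ∈ Finset.univ, 0 ≤ I (some k) * (I (some k) * C.resistance k) := fun k _ => by
    rw [← mul_assoc]
    exact mul_nonneg (mul_self_nonneg _) (C.resistance_pos k).le
  rw [Finset.sum_eq_zero_iff_of_nonneg hnn] at h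
  have hsome : ∀ k, I (some k) = 0 := by
    intro k
    have := h k (Finset.mem_univ k)
    rw [← mul_assoc] at this
    exact mul_self_eq_zero.1 ((mul_eq_zero.1 this).resolve_right (C.resistance_pos k).ne')
  have hnone := hI (C.tgt none)
  rw [Fintype.sum_option, Fintype.sum_option, if_pos rfl, if_neg (C.src_ne_tgt none)] at hnone
  simp only [hsome, ite_self, Finset.sum_const_zero, add_zero] at hnone
  funext e
  cases e with
  | none => exact hnone
  | some k => exact hsome k

/-- There are unique currents that satisfy the first Kirchhoff law at all terminals and the second
one along all cycles. -/
theorem existsUnique_power_eq : ∃! I : Option ρ → ℝ, C.NodeLaw I ∧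
    ∀ z : Option ρ → ℝ, C.NodeLaw z → C.power I z = z none * C.voltage := by
  have huniq : ∀ I : Option ρ → ℝ, C.NodeLaw I → (∀ z, C.NodeLaw z → C.power I z = 0) → I = 0 :=
    fun I hI h => C.eq_zero_of_power_self_eq_zero hI (h I hI)
  let T : C.cycleSpace →ₗ[ℝ] Module.Dual ℝ C.cycleSpace :=
    C.power.domRestrict₁₂ C.cycleSpace C.cycleSpace
  have hT : Function.Injective T := by
    rw [injective_iff_map_eq_zero]
    intro x hx
    exact Subtype.ext (huniq x x.2 fun z hz => LinearMap.congr_fun hx ⟨z, hz⟩)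
  -- A finite-dimensional space and its dual have the same dimension, so uniqueness yields
  -- existence.
  have hsurj : Function.Surjective T :=
    (LinearMap.injective_iff_surjective_of_finrank_eq_finrank
      Subspace.dual_finrank_eq.symm).1 hT
  let β : Module.Dual ℝ C.cycleSpace :=
    (C.voltage • LinearMap.proj (R := ℝ) (φ := fun _ : Option ρ => ℝ) none).domRestrict C.cycleSpace
  obtain ⟨I, hI⟩ := hsurj β
  have hIz : ∀ z : Option ρ → ℝ, C.NodeLaw z → C.power I z = z none * C.voltage := by
    intro z hz
    rw [mul_comm]
    exact LinearMap.congr_fun hI ⟨z, hz⟩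
  refine ⟨I, ⟨I.2, hIz⟩, fun I' ⟨hI', h'⟩ => ?_⟩
  refine sub_eq_zero.1 (huniq _ (C.cycleSpace.sub_mem hI' I.2) fun z hz => ?_)
  rw [map_sub, LinearMap.sub_apply, h' z hz, hIz z hz, sub_self]

variable [Finite V]

/-- A loop law is the cycle equation at `z = contour f`, which is a cycle because `F ⊆ faces`;
conversely, the bounded contours already force the equation at all cycles. -/
theorem loopLaw_iff_of_subset {F : Set (Set ℂ)} (hF : F ⊆ C.faces) (hF' : C.boundedFaces ⊆ F)
    (I : Option ρ → ℝ) : (∀ f ∈ F, C.LoopLaw f I) ↔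
      ∀ z : Option ρ → ℝ, C.NodeLaw z → C.power I z = z none * C.voltage := by
  constructor
  · intro h z hz
    -- Giving the battery the value `-voltage` turns each law into orthogonality to a single vector
    -- on all edges.
    have hsum : ∀ u : Option ρ → ℝ, ∑ e : Option ρ, u e *
        (e.elim (-C.voltage) fun k => I (some k) * C.resistance k)
        = C.power I u - u none * C.voltage := by
      intro u
      rw [Fintype.sum_option, power_apply]
      simp only [Option.elim_none, Option.elim_some]
      ring
    have := C.sum_mul_eq_zero_of_boundedFaces (z := z)
      (y := fun e => e.elim (-C.voltage) fun k => I (some k) * C.resistance k) ?_ hz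
    · rw [hsum] at this
      exact sub_eq_zero.1 this
    · intro f hf
      rw [hsum]
      exact sub_eq_zero.2 (h f (hF' hf))
  · intro h f hf
    exact h _ (C.isCycle_contour (hF hf))

theorem existsUnique_solvesKirchhoff {F : Set (Set ℂ)} (hF : F ⊆ C.faces)
    (hF' : C.boundedFaces ⊆ F) : ∃! I : Option ρ → ℝ, C.SolvesKirchhoff F I := by
  simp only [SolvesKirchhoff, C.loopLaw_iff_of_subset hF hF']
  exact C.existsUnique_power_eq

end PlaneCircuit

theorem mainTheorem4 {V ρ : Type*} [Finite V] [Fintype ρ] (C : PlaneCircuit V ρ) :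
    (∃! I : Option ρ → ℝ, C.SolvesKirchhoff C.faces I) ∧
      (∃! I : Option ρ → ℝ, C.SolvesKirchhoff C.boundedFaces I) :=
  ⟨C.existsUnique_solvesKirchhoff subset_rfl fun _ hf => hf.1,
    C.existsUnique_solvesKirchhoff (fun _ hf => hf.1) subset_rfl⟩
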